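/- A function $f:\mathbb N\to\mathbb R$ has subexponential growth if for every $\delta>0$ there is $C_\delta>0$ with $f(n)\le C_\delta(1+\delta)^n$ for all $n\ge 1$. Let $f$ be such a function and let $G$ be an infinite connected simple graph with $|B_r(x)|\le f(r)$ for every vertex $x$ and every $r\in\mathbb N$, where $B_r(x)$ is the ball of radius $r$ around $x$ in the graph metric. A Følner sequence in $G$ is a sequence $\{G_n\}_{n=1}^\infty$ of nonempty finite induced subgraphs of $G$ with $\bigcup_n G_n=G$ and $\lim_{n\to\infty}|\partial G_n|/|V(G_n)|=0$, where $\partial G_n$ is the set of vertices of $G_n$ that are adjacent in $G$ to a vertex outside $G_n$. A sequence of finite simple graphs $H_n$ whose vertex degrees are bounded by some $d\ge 2$ is weakly convergent if $|V(H_n)|\to\infty$ and, for every $r\ge1$ and every finite connected rooted graph $\alpha$ with vertex degrees at most $d$ and all vertices at distance at most $r$ from the root, the limit of the proportion of those vertices $x\in V(H_n)$ for which the ball $B_r(x)$ of $H_n$, rooted at $x$, is rooted isomorphic to $\alpha$ exists as $n\to\infty$. Assume that $G$ has uniform patch frequency (UPF), that is, every Følner sequence in $G$ is weakly convergent. For a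 finite graph $H$ let $I(H)$ be the maximal size of an independent set of vertices, $M(H)$ the maximal size of a matching, $\pi^I_H(\lambda)=\sum_{S}\lambda^{|S|}$ the sum over all independent sets $S\subseteq V(H)$, and $\pi^M_H(\lambda)=\sum_{T}\lambda^{|T|}$ the sum over all matchings $T\subseteq E(H)$ (the empty set is included in both sums). Theorem. Let $\{G_n\}_{n=1}^\infty$ be a Følner sequence in $G$. Then (a) $\lim_{n\to\infty} \dfrac{I(G_n)}{|V(G_n)|}$ exists; (b) $\lim_{n\to\infty} \dfrac{M(G_n)}{|V(G_n)|}$ exists; (c) $\lim_{n\to\infty} \dfrac{\log \pi^I_{G_n}(\lambda)}{|V(G_n)|}$ exists for every $0<\lambda<\infty$; (d) $\lim_{n\to\infty} \dfrac{\log \pi^M_{G_n}(\lambda)}{|V(G_n)|}$ exists for every $0<\lambda<\infty$. All these limits are finite real numbers. -/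

import Mathlib

open Filter Topology

universe u

/-- A function `f : ℕ → ℝ` of subexponential growth. -/
def SubexpGrowth (f : ℕ → ℝ) : Prop :=
  ∀ δ : ℝ, 0 < δ → ∃ C : ℝ, 0 < C ∧ ∀ n : ℕ, 1 ≤ n → f n ≤ C * (1 + δ) ^ n

namespace SimpleGraph

variable {V : Type u}

/-- The vertex set of the ball `B_r(x)` for the graph metric; the extended distance is used so that
vertices in other components are at distance `⊤`. -/
def ballSet (G : SimpleGraph V) (x : V) (r : ℕ) : Set V :=
  {y | G.edist x y ≤ (r : ℕ∞)}

/-- The root, as a vertex of its own ball. -/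
def ballRoot (G : SimpleGraph V) (x : V) (r : ℕ) : G.ballSet x r :=
  ⟨x, by simp [ballSet]⟩

/-- `|B_r(x)| ≤ f(r)` for every vertex `x` and every radius `r`. -/
def GrowthBoundedBy (G : SimpleGraph V) (f : ℕ → ℝ) : Prop :=
  ∀ (x : V) (r : ℕ), (G.ballSet x r).Finite ∧ ((G.ballSet x r).ncard : ℝ) ≤ f r

/-- Every vertex has at most `d` neighbours. -/
def DegreeBoundedBy (G : SimpleGraph V) (d : ℕ) : Prop :=
  ∀ x : V, (G.neighborSet x).Finite ∧ (G.neighborSet x).ncard ≤ d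

end SimpleGraph

/-- A rooted `(r,d)`-ball: a finite connected simple graph of maximal degree at most `d` with a
root from which every vertex is at distance at most `r`. The vertex set is taken to be some
`Fin n`, so that every isomorphism class is represented. -/
structure RootedBall (r d : ℕ) where
  n : ℕ
  graph : SimpleGraph (Fin n)
  root : Fin n
  connected : graph.Connected
  degree_le : graph.DegreeBoundedBy d
  dist_le : ∀ y, graph.dist root y ≤ r

/-- The vertices `x` of `H` whose rooted `r`-ball (the subgraph induced on `B_r(x)`, rooted at `x`)
is isomorphic to `α` by an isomorphism that maps root to root. -/
def patchSet {W : Type u} (H : SimpleGraph W) {r d : ℕ} (α : RootedBall r d) : Set W :=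
  {x | ∃ φ : α.graph ≃g H.induce (H.ballSet x r), φ α.root = H.ballRoot x r}

/-- The frequency `p_H(α)` of the patch `α` in a finite graph `H`. -/
noncomputable def patchFreq {W : Type u} [Fintype W] (H : SimpleGraph W) {r d : ℕ}
    (α : RootedBall r d) : ℝ :=
  ((patchSet H α).ncard : ℝ) / (Fintype.card W : ℝ)

/-- Weak (Benjamini–Schramm) convergence of a sequence of finite graphs of maximal degree at most
`d`, whose numbers of vertices tend to infinity. -/
def WeaklyConvergentIn (d : ℕ) {W : ℕ → Type u} [∀ n, Fintype (W n)]
    (H : ∀ n, SimpleGraph (W n)) : Prop :=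
  (∀ n, (H n).DegreeBoundedBy d) ∧
  Tendsto (fun n => Fintype.card (W n)) atTop atTop ∧
  ∀ r : ℕ, 1 ≤ r → ∀ α : RootedBall r d,
    ∃ p : ℝ, Tendsto (fun n => patchFreq (H n) α) atTop (𝓝 p)

/-- Weak convergence of a sequence of finite graphs of uniformly bounded degree. For a given
sequence the condition does not depend on the choice of the degree bound `d`, since patches of
larger degree never occur. -/
def WeaklyConvergent {W : ℕ → Type u} [∀ n, Fintype (W n)] (H : ∀ n, SimpleGraph (W n)) : Prop :=
  ∃ d : ℕ, 2 ≤ d ∧ WeaklyConvergentIn d H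

namespace SimpleGraph

variable {V : Type u}

/-- The finite subgraph of `G` induced on the finite vertex set `F`. -/
abbrev finInduce (G : SimpleGraph V) (F : Finset V) : SimpleGraph (F : Set V) :=
  G.induce (F : Set V)

/-- The inner vertex boundary of `F`. -/
def innerBoundary (G : SimpleGraph V) (F : Finset V) : Set V :=
  {p | p ∈ F ∧ ∃ q, q ∉ F ∧ G.Adj p q}

/-- The (nonempty) finite subgraphs of `G` induced on the sets `F n` form a Følner sequence: their
union is `G`, and `|∂ F n| / |F n| → 0`. -/
structure IsFolner (G : SimpleGraph V) (F : ℕ → Finset V) : Prop where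
  nonempty : ∀ n, (F n).Nonempty
  iSup_eq : (⨆ n, (⊤ : G.Subgraph).induce (F n : Set V)) = ⊤
  tendsto : Tendsto (fun n => ((G.innerBoundary (F n)).ncard : ℝ) / ((F n).card : ℝ)) atTop (𝓝 0)

/-- Uniform patch frequency: every Følner sequence of `G` is weakly convergent. -/
def UPF (G : SimpleGraph V) : Prop :=
  ∀ F : ℕ → Finset V, G.IsFolner F → WeaklyConvergent (fun n => G.finInduce (F n))

end SimpleGraph

section Parameters

variable {W : Type u} [Fintype W]

open Classical in
/-- The independent sets of vertices of a finite graph. -/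
noncomputable def indepSets (H : SimpleGraph W) : Finset (Finset W) :=
  Finset.univ.filter (fun S => H.IsIndepSet (S : Set W))

open Classical in
/-- The matchings of a finite graph: sets of edges no two of which share a vertex. -/
noncomputable def matchings (H : SimpleGraph W) : Finset (Finset (Sym2 W)) :=
  Finset.univ.filter (fun T => (∀ e ∈ T, e ∈ H.edgeSet) ∧
    ∀ e ∈ T, ∀ e' ∈ T, e ≠ e' → ∀ v, v ∈ e → v ∉ e')

/-- The maximal size of a matching. -/
noncomputable def maxMatching (H : SimpleGraph W) : ℕ :=
  (matchings H).sup Finset.card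

/-- The partition function of independent sets. -/
noncomputable def indepPartition (H : SimpleGraph W) (lam : ℝ) : ℝ :=
  ∑ S ∈ indepSets H, lam ^ S.card

/-- The partition function of matchings. -/
noncomputable def matchingPartition (H : SimpleGraph W) (lam : ℝ) : ℝ :=
  ∑ T ∈ matchings H, lam ^ T.card

end Parameters

/-! All four quantities come from a parameter `q` of finite vertex sets that depends only on the
induced graph, is additive over parts with no edges between them, and moves by a bounded amount when
a vertex is added (`IsAdditiveParameter`). For (a) and (c) these are the independence number and the
logarithm of the partition function. For (b) and (d) they are the same parameters of the graph whose
vertices are edges, adjacent when they meet.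

Such a `q` converges because it is nearly a sum of local terms. Each vertex `u` independently draws
a start time in `{0, …, R}` and then emits a signal of unit speed; the cell of `v` collects the
vertices that the signal of `v` reaches at least two units before every other. Distinct cells have
no edges between them (`disjoint_cell`), so `q` of their union is the sum over cells, and the error
is at most a constant times the number of uncovered vertices. A cell depends only on the ball of
radius `3 * R + 2` around its centre (`cell_induce_ballSet`), so its expected contribution is a
rooted-ball invariant, whose average converges along a weakly convergent sequence.

It remains to cover most vertices. Start times with `P(t ≤ s) = (1 - 1/k)^(R - s)` make a lead of
two units cost only a factor `(1 - 1/k)^2`, up to a truncation error `(1 - 1/k)^(R - 1)` for each of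
the at most `f R` candidate centres (`exists_isTimer`, `expect_exists_mem_cell_ge`). Subexponential
growth of `f` makes the total loss arbitrarily small (`SubexpGrowth.exists_radius`). -/

namespace SimpleGraph

/-! ### Independent sets inside a finite vertex set -/

section IndepIn

variable {E : Type u}

open Classical in
/-- The independent sets of `L` contained in the finite set `X`. -/
noncomputable def indepIn (L : SimpleGraph E) (X : Finset E) : Finset (Finset E) :=
  X.powerset.filter (fun A => L.IsIndepSet (A : Set E))

/-- The maximal size of an independent set contained in `X`. -/
noncomputable def indepMax (L : SimpleGraph E) (X : Finset E) : ℕ :=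
  (L.indepIn X).sup Finset.card

/-- The partition function of the independent sets contained in `X`. -/
noncomputable def indepSum (L : SimpleGraph E) (lam : ℝ) (X : Finset E) : ℝ :=
  ∑ A ∈ L.indepIn X, lam ^ A.card

variable {L : SimpleGraph E} {X Y A B : Finset E}

theorem mem_indepIn : A ∈ L.indepIn X ↔ A ⊆ X ∧ L.IsIndepSet (A : Set E) := by
  simp [indepIn]

theorem IsIndepSet.subset {s t : Set E} (ht : L.IsIndepSet t) (h : s ⊆ t) : L.IsIndepSet s :=
  Set.Pairwise.mono h ht

theorem empty_mem_indepIn : ∅ ∈ L.indepIn X := by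
  simp [mem_indepIn, IsIndepSet]

theorem indepIn_mono (h : X ⊆ Y) : L.indepIn X ⊆ L.indepIn Y := fun A hA => by
  rw [mem_indepIn] at hA ⊢
  exact ⟨hA.1.trans h, hA.2⟩

theorem inter_mem_indepIn [DecidableEq E] (hA : A ∈ L.indepIn Y) : A ∩ X ∈ L.indepIn X := by
  rw [mem_indepIn] at hA ⊢
  exact ⟨Finset.inter_subset_right, hA.2.subset (by simp)⟩

theorem union_mem_indepIn [DecidableEq E] (hn : ∀ x ∈ X, ∀ y ∈ Y, ¬ L.Adj x y)
    (hA : A ∈ L.indepIn X) (hB : B ∈ L.indepIn Y) : A ∪ B ∈ L.indepIn (X ∪ Y) := by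
  rw [mem_indepIn] at hA hB ⊢
  refine ⟨Finset.union_subset_union hA.1 hB.1, ?_⟩
  intro x hx y hy hxy
  simp only [Finset.coe_union, Set.mem_union, Finset.mem_coe] at hx hy
  rcases hx with hx | hx <;> rcases hy with hy | hy
  · exact hA.2 hx hy hxy
  · exact hn x (hA.1 hx) y (hB.1 hy)
  · exact fun h => hn y (hA.1 hy) x (hB.1 hx) h.symm
  · exact hB.2 hx hy hxy

theorem indepMax_mono (h : X ⊆ Y) : L.indepMax X ≤ L.indepMax Y :=
  Finset.sup_mono (indepIn_mono h)

theorem card_le_indepMax (hA : A ∈ L.indepIn X) : A.card ≤ L.indepMax X :=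
  Finset.le_sup (f := Finset.card) hA

theorem exists_card_eq_indepMax (L : SimpleGraph E) (X : Finset E) :
    ∃ A ∈ L.indepIn X, A.card = L.indepMax X := by
  obtain ⟨A, hA, h⟩ := Finset.exists_mem_eq_sup (L.indepIn X) ⟨∅, empty_mem_indepIn⟩ Finset.card
  exact ⟨A, hA, h.symm⟩

theorem indepMax_union_le [DecidableEq E] :
    L.indepMax (X ∪ Y) ≤ L.indepMax X + L.indepMax Y := by
  refine Finset.sup_le fun A hA => ?_
  have h : A = (A ∩ X) ∪ (A ∩ Y) := by
    rw [← Finset.inter_union_distrib_left, Finset.inter_eq_left.2 (mem_indepIn.1 hA).1]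
  calc A.card = ((A ∩ X) ∪ (A ∩ Y)).card := by rw [← h]
    _ ≤ (A ∩ X).card + (A ∩ Y).card := Finset.card_union_le _ _
    _ ≤ _ := add_le_add (card_le_indepMax (inter_mem_indepIn hA))
      (card_le_indepMax (inter_mem_indepIn hA))

theorem indepMax_le_card : L.indepMax X ≤ X.card :=
  Finset.sup_le fun _ hA => Finset.card_le_card (mem_indepIn.1 hA).1

theorem indepMax_union [DecidableEq E] (hd : Disjoint X Y)
    (hn : ∀ x ∈ X, ∀ y ∈ Y, ¬ L.Adj x y) :
    L.indepMax (X ∪ Y) = L.indepMax X + L.indepMax Y := by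
  refine le_antisymm indepMax_union_le ?_
  obtain ⟨A, hA, hA'⟩ := exists_card_eq_indepMax L X
  obtain ⟨B, hB, hB'⟩ := exists_card_eq_indepMax L Y
  rw [← hA', ← hB', ← Finset.card_union_of_disjoint
    (Finset.disjoint_of_subset_left (mem_indepIn.1 hA).1
      (Finset.disjoint_of_subset_right (mem_indepIn.1 hB).1 hd))]
  exact card_le_indepMax (union_mem_indepIn hn hA hB)

theorem indepSum_mono {lam : ℝ} (hl : 0 < lam) (h : X ⊆ Y) :
    L.indepSum lam X ≤ L.indepSum lam Y :=
  Finset.sum_le_sum_of_subset_of_nonneg (indepIn_mono h) fun _ _ _ => by positivity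

theorem indepSum_pos {lam : ℝ} (hl : 0 < lam) : 0 < L.indepSum lam X :=
  Finset.sum_pos (fun _ _ => by positivity) ⟨∅, empty_mem_indepIn⟩

/-- Removing `e` maps the independent sets that contain `e` injectively to independent subsets of
`X`, at the price of one factor `lam`. -/
theorem indepSum_insert_le [DecidableEq E] {lam : ℝ} (hl : 0 < lam) (e : E) :
    L.indepSum lam (insert e X) ≤ (1 + lam) * L.indepSum lam X := by
  classical
  by_cases he : e ∈ X
  · rw [Finset.insert_eq_of_mem he]
    nlinarith [indepSum_pos (L := L) (X := X) hl]
  · unfold indepSum indepIn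
    rw [Finset.sum_filter, Finset.sum_filter, Finset.sum_powerset_insert he, add_mul, one_mul,
      Finset.mul_sum]
    refine add_le_add le_rfl (Finset.sum_le_sum fun A hA => ?_)
    have heA : e ∉ A := fun h => he (Finset.mem_powerset.1 hA h)
    by_cases hi : L.IsIndepSet (A : Set E)
    · rw [if_pos hi, Finset.card_insert_of_notMem heA, pow_succ, mul_comm]
      split_ifs
      · exact le_rfl
      · positivity
    · rw [if_neg hi, if_neg, mul_zero]
      exact fun h => hi (h.subset (by simp))

/-- Without edges across, an independent set of the union is a free choice of its traces on the two
parts. -/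
theorem indepSum_union [DecidableEq E] {lam : ℝ} (hd : Disjoint X Y)
    (hn : ∀ x ∈ X, ∀ y ∈ Y, ¬ L.Adj x y) :
    L.indepSum lam (X ∪ Y) = L.indepSum lam X * L.indepSum lam Y := by
  unfold indepSum
  rw [Finset.sum_mul_sum, ← Finset.sum_product']
  symm
  refine Finset.sum_nbij' (fun P => P.1 ∪ P.2) (fun A => (A ∩ X, A ∩ Y)) ?_ ?_ ?_ ?_ ?_
  · rintro ⟨A, B⟩ h
    rw [Finset.mem_product] at h
    exact union_mem_indepIn hn h.1 h.2
  · intro A hA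
    exact Finset.mem_product.2 ⟨inter_mem_indepIn hA, inter_mem_indepIn hA⟩
  · rintro ⟨A, B⟩ h
    rw [Finset.mem_product] at h
    have hA := (mem_indepIn.1 h.1).1
    have hB := (mem_indepIn.1 h.2).1
    have h1 : Disjoint B X := Finset.disjoint_of_subset_left hB hd.symm
    have h2 : Disjoint A Y := Finset.disjoint_of_subset_left hA hd
    simp [Finset.union_inter_distrib_right, Finset.inter_eq_left.2 hA, Finset.inter_eq_left.2 hB,
      Finset.disjoint_iff_inter_eq_empty.1 h1, Finset.disjoint_iff_inter_eq_empty.1 h2]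
  · intro A hA
    rw [← Finset.inter_union_distrib_left, Finset.inter_eq_left.2 (mem_indepIn.1 hA).1]
  · rintro ⟨A, B⟩ h
    rw [Finset.mem_product] at h
    rw [Finset.card_union_of_disjoint
      (Finset.disjoint_of_subset_left (mem_indepIn.1 h.1).1
        (Finset.disjoint_of_subset_right (mem_indepIn.1 h.2).1 hd)), pow_add]

theorem indepIn_map {E' : Type u} {L' : SimpleGraph E'} (φ : E ↪ E')
    (hφ : ∀ a ∈ X, ∀ b ∈ X, L'.Adj (φ a) (φ b) ↔ L.Adj a b) :
    L'.indepIn (X.map φ) = (L.indepIn X).map (Finset.mapEmbedding φ).toEmbedding := by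
  ext A
  simp only [mem_indepIn, Finset.mem_map, RelEmbedding.coe_toEmbedding,
    Finset.mapEmbedding_apply]
  have key : ∀ B ⊆ X, (L'.IsIndepSet (B.map φ : Finset E') ↔ L.IsIndepSet (B : Set E)) := by
    intro B hB
    constructor
    · intro h a ha b hb hab hadj
      exact h (by simpa using ha) (by simpa using hb) (φ.injective.ne hab)
        ((hφ a (hB ha) b (hB hb)).2 hadj)
    · intro h a ha b hb hab hadj
      simp only [Finset.coe_map, Set.mem_image, Finset.mem_coe] at ha hb
      obtain ⟨a, ha, rfl⟩ := ha
      obtain ⟨b, hb, rfl⟩ := hb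
      exact h ha hb (fun h => hab (by rw [h])) ((hφ a (hB ha) b (hB hb)).1 hadj)
  constructor
  · rintro ⟨h1, h2⟩
    obtain ⟨B, hB, rfl⟩ := Finset.subset_map_iff.1 h1
    exact ⟨B, ⟨hB, (key B hB).1 h2⟩, rfl⟩
  · rintro ⟨B, ⟨hB, h⟩, rfl⟩
    exact ⟨Finset.map_subset_map.2 hB, (key B hB).2 h⟩

theorem indepMax_map {E' : Type u} {L' : SimpleGraph E'} (φ : E ↪ E')
    (hφ : ∀ a ∈ X, ∀ b ∈ X, L'.Adj (φ a) (φ b) ↔ L.Adj a b) :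
    L'.indepMax (X.map φ) = L.indepMax X := by
  unfold indepMax
  rw [indepIn_map φ hφ, Finset.sup_map]
  congr 1
  ext A
  simp

theorem indepSum_map {E' : Type u} {L' : SimpleGraph E'} {lam : ℝ} (φ : E ↪ E')
    (hφ : ∀ a ∈ X, ∀ b ∈ X, L'.Adj (φ a) (φ b) ↔ L.Adj a b) :
    L'.indepSum lam (X.map φ) = L.indepSum lam X := by
  unfold indepSum
  rw [indepIn_map φ hφ, Finset.sum_map]
  simp

end IndepIn

/-! ### Additive Lipschitz parameters -/

/-- A real parameter of finite sets of vertices that depends on the induced graph only, is additive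
on disjoint unions without edges between the parts, and changes by at most `C` when a vertex is
added, in graphs of maximal degree at most `d`. -/
structure IsAdditiveParameter (d : ℕ) (C : ℝ)
    (q : ∀ ⦃W : Type u⦄, SimpleGraph W → Finset W → ℝ) : Prop where
  map : ∀ {W W' : Type u} {H : SimpleGraph W} {H' : SimpleGraph W'} (φ : H ↪g H') (S : Finset W),
    q H' (S.map φ.toEmbedding) = q H S
  insert : ∀ {W : Type u} [DecidableEq W] {H : SimpleGraph W}, H.DegreeBoundedBy d →
    ∀ (x : W) (S : Finset W), |q H (Insert.insert x S) - q H S| ≤ C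
  union : ∀ {W : Type u} [DecidableEq W] {H : SimpleGraph W} {S T : Finset W}, Disjoint S T →
    (∀ x ∈ S, ∀ y ∈ T, ¬ H.Adj x y) → q H (S ∪ T) = q H S + q H T

namespace IsAdditiveParameter

variable {d : ℕ} {C : ℝ} {q : ∀ ⦃W : Type u⦄, SimpleGraph W → Finset W → ℝ}

theorem empty (hq : IsAdditiveParameter d C q) {W : Type u} (H : SimpleGraph W) :
    q H ∅ = 0 := by
  classical
  have := hq.union (H := H) (S := ∅) (T := ∅) (by simp) (by simp)
  simpa using this

theorem abs_sub_le (hq : IsAdditiveParameter d C q) {W : Type u} {H : SimpleGraph W}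
    (hd : H.DegreeBoundedBy d) [DecidableEq W] (S T : Finset W) :
    |q H (T ∪ S) - q H S| ≤ C * T.card := by
  induction T using Finset.induction_on with
  | empty => simp
  | insert x T hx ih =>
    rw [Finset.insert_union, Finset.card_insert_of_notMem hx]
    push_cast
    have h1 := hq.insert hd x (T ∪ S)
    have h2 := _root_.abs_sub_le (q H (Insert.insert x (T ∪ S))) (q H (T ∪ S)) (q H S)
    linarith

theorem biUnion (hq : IsAdditiveParameter d C q) {W ι : Type u} [DecidableEq W]
    {H : SimpleGraph W} (I : Finset ι) (D : ι → Finset W)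
    (hD : ∀ i j, i ≠ j → Disjoint (D i) (D j) ∧ ∀ x ∈ D i, ∀ y ∈ D j, ¬ H.Adj x y) :
    q H (I.biUnion D) = ∑ i ∈ I, q H (D i) := by
  classical
  induction I using Finset.induction_on with
  | empty => simpa using hq.empty H
  | insert i I hi ih =>
    rw [Finset.biUnion_insert, Finset.sum_insert hi, ← ih]
    refine hq.union ?_ ?_
    · rw [Finset.disjoint_biUnion_right]
      exact fun j hj => (hD i j (fun h => hi (h ▸ hj))).1
    · intro x hx y hy
      obtain ⟨j, hj, hy⟩ := Finset.mem_biUnion.1 hy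
      exact (hD i j (fun h => hi (h ▸ hj))).2 x hx y hy

end IsAdditiveParameter

theorem abs_indepMax_insert_sub_le {E : Type u} [DecidableEq E] {L : SimpleGraph E} (e : E)
    (X : Finset E) : |(L.indepMax (insert e X) : ℝ) - L.indepMax X| ≤ 1 := by
  have h1 : L.indepMax X ≤ L.indepMax (insert e X) := indepMax_mono (Finset.subset_insert _ _)
  have h2 : L.indepMax (insert e X) ≤ L.indepMax {e} + L.indepMax X := by
    rw [Finset.insert_eq]; exact indepMax_union_le
  have h3 : L.indepMax {e} ≤ 1 := by simpa using indepMax_le_card (L := L) (X := {e})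
  have h4 : L.indepMax (insert e X) ≤ 1 + L.indepMax X := by omega
  rify at h1 h4
  rw [abs_le]; constructor <;> linarith

theorem isAdditiveParameter_indepMax (d : ℕ) :
    IsAdditiveParameter.{u} d 1 (fun _ H S => (H.indepMax S : ℝ)) where
  map φ S := by
    rw [indepMax_map φ.toEmbedding fun a _ b _ => φ.map_rel_iff]
  insert _ x S := abs_indepMax_insert_sub_le x S
  union hd hn := by
    rw [indepMax_union hd hn]; push_cast; rfl

theorem log_indepSum_insert {E : Type u} [DecidableEq E] {L : SimpleGraph E} {lam : ℝ}
    (hl : 0 < lam) (e : E) (X : Finset E) :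
    |Real.log (L.indepSum lam (insert e X)) - Real.log (L.indepSum lam X)| ≤
      Real.log (1 + lam) := by
  have h0 := indepSum_pos (L := L) (X := X) hl
  have h1 : L.indepSum lam X ≤ L.indepSum lam (insert e X) :=
    indepSum_mono hl (Finset.subset_insert _ _)
  have h2 := Real.log_le_log (indepSum_pos hl) (indepSum_insert_le (L := L) (X := X) hl e)
  rw [Real.log_mul (by positivity) h0.ne'] at h2
  have h3 := Real.log_le_log h0 h1
  have h4 := Real.log_nonneg (x := 1 + lam) (by linarith)
  rw [abs_le]; constructor <;> linarith

theorem isAdditiveParameter_log_indepSum (d : ℕ) {lam : ℝ} (hl : 0 < lam) :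
    IsAdditiveParameter.{u} d (Real.log (1 + lam))
      (fun _ H S => Real.log (H.indepSum lam S)) where
  map φ S := by
    rw [indepSum_map φ.toEmbedding fun a _ b _ => φ.map_rel_iff]
  insert _ x S := log_indepSum_insert hl x S
  union hd hn := by
    rw [indepSum_union hd hn, Real.log_mul (indepSum_pos hl).ne' (indepSum_pos hl).ne']

/-! ### Matchings as independent sets of edges -/

/-- Two distinct unordered pairs are adjacent if they intersect. -/
def pairGraph (W : Type u) : SimpleGraph (Sym2 W) where
  Adj e e' := e ≠ e' ∧ ∃ v, v ∈ e ∧ v ∈ e'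
  symm := ⟨fun _ _ h => ⟨h.1.symm, h.2.imp fun _ h => h.symm⟩⟩
  loopless := ⟨fun _ h => h.1 rfl⟩

open Classical in
/-- The edges of `H` with both ends in `S`. -/
noncomputable def edgesIn {W : Type u} (H : SimpleGraph W) (S : Finset W) : Finset (Sym2 W) :=
  S.sym2.filter (fun e => e ∈ H.edgeSet)

theorem mem_edgesIn {W : Type u} {H : SimpleGraph W} {S : Finset W} {e : Sym2 W} :
    e ∈ H.edgesIn S ↔ (∀ v ∈ e, v ∈ S) ∧ e ∈ H.edgeSet := by
  simp [edgesIn, Finset.mem_sym2_iff]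

theorem edgesIn_map {W W' : Type u} {H : SimpleGraph W} {H' : SimpleGraph W'} (φ : H ↪g H')
    (S : Finset W) :
    H'.edgesIn (S.map φ.toEmbedding) = (H.edgesIn S).map φ.toEmbedding.sym2Map := by
  classical
  ext e
  simp only [mem_edgesIn, Finset.mem_map]
  constructor
  · induction e with
    | h a b =>
      rintro ⟨h1, h2⟩
      obtain ⟨a, ha, rfl⟩ := h1 a (by simp)
      obtain ⟨b, hb, rfl⟩ := h1 b (by simp)
      exact ⟨s(a, b), ⟨by simp [ha, hb], φ.map_rel_iff.1 h2⟩, rfl⟩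
  · rintro ⟨e, ⟨h1, h2⟩, rfl⟩
    induction e with
    | h a b =>
      exact ⟨by simpa using h1, φ.map_rel_iff.2 h2⟩

theorem edgesIn_union {W : Type u} [DecidableEq W] {H : SimpleGraph W} {S T : Finset W}
    (hn : ∀ x ∈ S, ∀ y ∈ T, ¬ H.Adj x y) :
    H.edgesIn (S ∪ T) = H.edgesIn S ∪ H.edgesIn T := by
  ext e
  induction e with
  | h a b =>
    simp only [mem_edgesIn, Finset.mem_union, Sym2.mem_iff, forall_eq_or_imp, forall_eq,
      mem_edgeSet]
    constructor
    · rintro ⟨⟨ha | ha, hb | hb⟩, hab⟩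
      · exact .inl ⟨⟨ha, hb⟩, hab⟩
      · exact (hn a ha b hb hab).elim
      · exact (hn b hb a ha hab.symm).elim
      · exact .inr ⟨⟨ha, hb⟩, hab⟩
    · rintro (⟨⟨ha, hb⟩, hab⟩ | ⟨⟨ha, hb⟩, hab⟩)
      · exact ⟨⟨.inl ha, .inl hb⟩, hab⟩
      · exact ⟨⟨.inr ha, .inr hb⟩, hab⟩

theorem not_pairGraph_adj {W : Type u} {H : SimpleGraph W} {S T : Finset W} (hd : Disjoint S T)
    {e e' : Sym2 W} (he : e ∈ H.edgesIn S) (he' : e' ∈ H.edgesIn T) :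
    ¬ ∃ v, v ∈ e ∧ v ∈ e' := by
  rintro ⟨v, hv, hv'⟩
  exact Finset.disjoint_left.1 hd ((mem_edgesIn.1 he).1 v hv) ((mem_edgesIn.1 he').1 v hv')

theorem disjoint_edgesIn {W : Type u} {H : SimpleGraph W} {S T : Finset W} (hd : Disjoint S T) :
    Disjoint (H.edgesIn S) (H.edgesIn T) := by
  rw [Finset.disjoint_left]
  intro e he he'
  refine not_pairGraph_adj hd he he' ?_
  induction e with
  | h a b => exact ⟨a, by simp, by simp⟩

theorem pairGraph_adj_map {W W' : Type u} (φ : W ↪ W') (e e' : Sym2 W) :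
    (pairGraph W').Adj (φ.sym2Map e) (φ.sym2Map e') ↔ (pairGraph W).Adj e e' := by
  refine and_congr φ.sym2Map.injective.ne_iff ?_
  simp only [Function.Embedding.sym2Map_apply, Sym2.mem_map]
  refine ⟨?_, ?_⟩
  · rintro ⟨_, ⟨v, hv, rfl⟩, ⟨w, hw, h⟩⟩
    rw [φ.injective h] at hw
    exact ⟨v, hv, hw⟩
  · rintro ⟨v, hv, hv'⟩
    exact ⟨φ v, ⟨v, hv, rfl⟩, ⟨v, hv', rfl⟩⟩

/-- The only new edges join `x` to its neighbours. This bounds the effect of one vertex by that of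
`d` edges. -/
theorem exists_edgesIn_insert {W : Type u} [DecidableEq W] {H : SimpleGraph W} {d : ℕ}
    (hd : H.DegreeBoundedBy d) (x : W) (S : Finset W) :
    ∃ T : Finset (Sym2 W), T.card ≤ d ∧ H.edgesIn (insert x S) = T ∪ H.edgesIn S := by
  classical
  obtain ⟨hf, hc⟩ := hd x
  let T := (hf.toFinset ∩ insert x S).image (fun y => s(x, y))
  refine ⟨T, ?_, ?_⟩
  · calc T.card ≤ (hf.toFinset ∩ insert x S).card := Finset.card_image_le
      _ ≤ hf.toFinset.card := Finset.card_le_card Finset.inter_subset_left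
      _ ≤ d := by rwa [← Set.ncard_eq_toFinset_card _ hf]
  · ext e
    induction e with
    | h a b =>
      simp only [T, mem_edgesIn, Finset.mem_union, Finset.mem_image, Finset.mem_inter,
        Set.Finite.mem_toFinset, mem_neighborSet, Finset.mem_insert, Sym2.mem_iff,
        forall_eq_or_imp, forall_eq, mem_edgeSet]
      constructor
      · rintro ⟨⟨ha | ha, hb⟩, hab⟩
        · subst ha
          exact .inl ⟨b, ⟨hab, hb⟩, rfl⟩
        · rcases hb with hb | hb
          · subst hb
            exact .inl ⟨a, ⟨hab.symm, .inr ha⟩, Sym2.eq_swap⟩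
          · exact .inr ⟨⟨ha, hb⟩, hab⟩
      · rintro (⟨y, ⟨hy, hy'⟩, h⟩ | ⟨⟨ha, hb⟩, hab⟩)
        · rcases Sym2.eq_iff.1 h with ⟨rfl, rfl⟩ | ⟨rfl, rfl⟩
          · exact ⟨⟨.inl rfl, hy'⟩, hy⟩
          · exact ⟨⟨hy', .inl rfl⟩, hy.symm⟩
        · exact ⟨⟨.inr ha, .inr hb⟩, hab⟩

/-- A parameter of sets of pairs, given by an additive parameter of the graph of intersecting pairs,
induces an additive parameter of sets of vertices. -/
theorem IsAdditiveParameter.edgesIn {d : ℕ} {C : ℝ} (g : ∀ ⦃E : Type u⦄, SimpleGraph E →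
    Finset E → ℝ) (hC : 0 ≤ C)
    (hmap : ∀ {E E' : Type u} {L : SimpleGraph E} {L' : SimpleGraph E'} {X : Finset E} (φ : E ↪ E'),
      (∀ a ∈ X, ∀ b ∈ X, L'.Adj (φ a) (φ b) ↔ L.Adj a b) → g L' (X.map φ) = g L X)
    (hinsert : ∀ {E : Type u} [DecidableEq E] {L : SimpleGraph E} (x : E) (X : Finset E),
      |g L (Insert.insert x X) - g L X| ≤ C)
    (hunion : ∀ {E : Type u} [DecidableEq E] {L : SimpleGraph E} {X Y : Finset E}, Disjoint X Y →
      (∀ x ∈ X, ∀ y ∈ Y, ¬ L.Adj x y) → g L (X ∪ Y) = g L X + g L Y) :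
    IsAdditiveParameter.{u} d (C * d) (fun W H S => g (pairGraph W) (H.edgesIn S)) where
  map φ S := by
    rw [edgesIn_map, hmap]
    exact fun a _ b _ => pairGraph_adj_map _ a b
  insert {W} _ H hd x S := by
    classical
    obtain ⟨T, hT, hS⟩ := exists_edgesIn_insert hd x S
    rw [hS]
    have : ∀ T : Finset (Sym2 W), |g (pairGraph W) (T ∪ H.edgesIn S) -
        g (pairGraph W) (H.edgesIn S)| ≤ C * T.card := by
      intro T
      induction T using Finset.induction_on with
      | empty => simp
      | insert e T he ih =>
        rw [Finset.insert_union, Finset.card_insert_of_notMem he]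
        push_cast
        have h1 := hinsert (L := pairGraph W) e (T ∪ H.edgesIn S)
        have h2 := _root_.abs_sub_le (g (pairGraph W) (Insert.insert e (T ∪ H.edgesIn S)))
          (g (pairGraph W) (T ∪ H.edgesIn S)) (g (pairGraph W) (H.edgesIn S))
        linarith
    exact (this T).trans (by gcongr)
  union hd hn := by
    classical
    rw [edgesIn_union hn, hunion (disjoint_edgesIn hd)]
    exact fun e he e' he' h => not_pairGraph_adj hd he he' h.2

theorem isAdditiveParameter_matchingMax (d : ℕ) :
    IsAdditiveParameter.{u} d (1 * d)
      (fun W H S => ((pairGraph W).indepMax (H.edgesIn S) : ℝ)) :=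
  IsAdditiveParameter.edgesIn (fun _ L X => (L.indepMax X : ℝ)) zero_le_one
    (fun φ h => by rw [indepMax_map φ h])
    (fun x X => abs_indepMax_insert_sub_le x X)
    (fun hd hn => by rw [indepMax_union hd hn]; push_cast; rfl)

theorem isAdditiveParameter_log_matchingSum (d : ℕ) {lam : ℝ} (hl : 0 < lam) :
    IsAdditiveParameter.{u} d (Real.log (1 + lam) * d)
      (fun W H S => Real.log ((pairGraph W).indepSum lam (H.edgesIn S))) :=
  IsAdditiveParameter.edgesIn (fun _ L X => Real.log (L.indepSum lam X))
    (Real.log_nonneg (by linarith))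
    (fun φ h => by rw [indepSum_map φ h])
    (fun x X => log_indepSum_insert hl x X)
    (fun hd hn => by
      rw [indepSum_union hd hn, Real.log_mul (indepSum_pos hl).ne' (indepSum_pos hl).ne'])

end SimpleGraph

/-! ### The parameters of the theorem as parameters of `Finset.univ` -/

section Identification

open SimpleGraph

variable {W : Type u} [Fintype W] (H : SimpleGraph W)

theorem indepNum_eq_indepMax : H.indepNum = H.indepMax Finset.univ := by
  classical
  refine le_antisymm ?_ ?_
  · obtain ⟨s, hs⟩ := H.exists_isNIndepSet_indepNum
    rw [← hs.card_eq]
    exact card_le_indepMax (mem_indepIn.2 ⟨Finset.subset_univ _, hs.isIndepSet⟩)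
  · obtain ⟨A, hA, h⟩ := exists_card_eq_indepMax H Finset.univ
    rw [← h]
    exact (mem_indepIn.1 hA).2.card_le_indepNum

theorem indepSets_eq_indepIn : indepSets H = H.indepIn Finset.univ := by
  ext A
  simp [indepSets, mem_indepIn]

theorem matchings_eq_indepIn : matchings H = (pairGraph W).indepIn (H.edgesIn Finset.univ) := by
  ext T
  simp only [matchings, Finset.mem_filter, Finset.mem_univ, true_and, mem_indepIn]
  refine and_congr ?_ ?_
  · simp [Finset.subset_iff, mem_edgesIn]
  · constructor
    · rintro h e he e' he' hne ⟨-, v, hv, hv'⟩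
      exact h e he e' he' hne v hv hv'
    · intro h e he e' he' hne v hv hv'
      exact h he he' hne ⟨hne, v, hv, hv'⟩

end Identification

/-! ### Random cells: separation and locality -/

namespace SimpleGraph

open scoped BigOperators

theorem edist_map_le {W W' : Type*} {H : SimpleGraph W} {H' : SimpleGraph W'} (φ : H →g H')
    (a b : W) : H'.edist (φ a) (φ b) ≤ H.edist a b := by
  by_cases h : H.edist a b = ⊤
  · rw [h]; exact le_top
  · obtain ⟨p, hp⟩ := exists_walk_of_edist_ne_top h
    rw [← hp, ← Walk.length_map φ p]
    exact edist_le _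

theorem edist_iso {W W' : Type*} {H : SimpleGraph W} {H' : SimpleGraph W'} (φ : H ≃g H')
    (a b : W) : H'.edist (φ a) (φ b) = H.edist a b := by
  refine le_antisymm (edist_map_le φ.toHom a b) ?_
  simpa using edist_map_le φ.symm.toHom (φ a) (φ b)

variable {W : Type u} {H : SimpleGraph W}

theorem edist_induce_le {s : Set W} (a b : s) : H.edist a b ≤ (H.induce s).edist a b :=
  edist_map_le (Embedding.induce s).toHom a b

/-- Under `h` a geodesic from `a` to `b` never leaves the ball, by the triangle inequality through
`a`. -/
theorem edist_induce_ballSet {v : W} {L : ℕ} (a b : H.ballSet v L)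
    (h : H.edist v a + H.edist a b ≤ L) :
    (H.induce (H.ballSet v L)).edist a b = H.edist a b := by
  classical
  refine le_antisymm ?_ (edist_induce_le a b)
  have hab : H.edist (a : W) b ≠ ⊤ := by
    intro h'
    rw [h', add_top] at h
    exact absurd h (by simp)
  obtain ⟨p, hp⟩ := exists_walk_of_edist_ne_top hab
  have hs : ∀ x ∈ p.support, x ∈ H.ballSet v L := by
    intro x hx
    calc H.edist v x ≤ H.edist v a + H.edist a x := SimpleGraph.edist_triangle
      _ ≤ H.edist v a + H.edist a b := by
        gcongr
        rw [← hp]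
        refine (edist_le (p.takeUntil x hx)).trans ?_
        exact_mod_cast p.length_takeUntil_le_length hx
      _ ≤ L := h
  rw [← hp]
  refine (edist_le (p.induce _ hs)).trans ?_
  have := congrArg Walk.length (p.map_induce hs)
  rw [Walk.length_map] at this
  exact_mod_cast this.le

theorem edist_induce_ballRoot {v : W} {L : ℕ} (a : H.ballSet v L) :
    (H.induce (H.ballSet v L)).edist (H.ballRoot v L) a = H.edist v a :=
  edist_induce_ballSet (H.ballRoot v L) a (by
    simp only [ballRoot, edist_self, zero_add]
    exact a.2)

variable [Finite W]

/-- Every vertex `u` sends out a signal at time `τ u`. The cell of `v` consists of the vertices that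
are reached by the signal of `v` at least two units of time before any other. -/
noncomputable def cell (H : SimpleGraph W) (τ : W → ℕ) (v : W) : Finset W :=
  (Set.toFinite {y | ∀ u, u ≠ v → (τ v : ℕ∞) + H.edist v y + 2 ≤ τ u + H.edist u y}).toFinset

variable {τ : W → ℕ}

theorem mem_cell {v y : W} :
    y ∈ H.cell τ v ↔ ∀ u, u ≠ v → (τ v : ℕ∞) + H.edist v y + 2 ≤ τ u + H.edist u y := by
  simp [cell]

/-- The vertex `y` competes for itself, at time `τ y ≤ R`. -/
theorem edist_le_of_mem_cell {R : ℕ} (hτ : ∀ u, τ u ≤ R) {v y : W} (h : y ∈ H.cell τ v) :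
    H.edist v y ≤ R := by
  by_cases hy : y = v
  · simp [hy]
  · have h1 := mem_cell.1 h y hy
    rw [edist_self, add_zero] at h1
    calc H.edist v y ≤ τ v + H.edist v y := le_add_self
      _ ≤ τ v + H.edist v y + 2 := le_self_add
      _ ≤ τ y := h1
      _ ≤ R := by exact_mod_cast hτ y

/-- Passing between vertices at distance at most one changes each arrival time by at most one. A
lead of two for `v` at `y` thus leaves `v` no later than `w` at `z`, against the lead of `w` there.
-/
theorem cell_separated {v w : W} (hvw : v ≠ w) {y z : W} (hy : y ∈ H.cell τ v)
    (hz : z ∈ H.cell τ w) : 1 < H.edist y z := by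
  by_contra! hyz
  have h1 := mem_cell.1 hy w hvw.symm
  have h2 := mem_cell.1 hz v hvw
  have h3 : H.edist w y ≤ H.edist w z + 1 := SimpleGraph.edist_triangle.trans (by
    rw [edist_comm (u := z)]; gcongr)
  have h4 : H.edist v z ≤ H.edist v y + 1 := SimpleGraph.edist_triangle.trans (by gcongr)
  -- Members of a cell are at finite distance from its centre, because each vertex reaches itself in
  -- finite time; all distances can then be taken in `ℕ`.
  by_cases hv : H.edist v y = ⊤
  · by_cases hv' : y = v
    · simp [hv'] at hv
    · have h5 := mem_cell.1 hy y hv'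
      rw [hv, edist_self] at h5
      simp at h5
  · have hw : H.edist w z ≠ ⊤ := by
      intro hw
      by_cases hw' : z = w
      · simp [hw'] at hw
      · have h5 := mem_cell.1 hz z hw'
        rw [hw, edist_self] at h5
        simp at h5
    have hv1 : H.edist v z ≠ ⊤ := ne_top_of_le_ne_top (by simpa using hv) h4
    have hw1 : H.edist w y ≠ ⊤ := ne_top_of_le_ne_top (by simpa using hw) h3
    lift H.edist v y to ℕ using hv with a
    lift H.edist w z to ℕ using hw with b
    lift H.edist v z to ℕ using hv1 with a'
    lift H.edist w y to ℕ using hw1 with b'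
    norm_cast at h1 h2 h3 h4
    omega

theorem disjoint_cell {v w : W} (hvw : v ≠ w) :
    Disjoint (H.cell τ v) (H.cell τ w) ∧ ∀ y ∈ H.cell τ v, ∀ z ∈ H.cell τ w, ¬ H.Adj y z := by
  refine ⟨?_, ?_⟩
  · rw [Finset.disjoint_left]
    intro y hy hy'
    have := cell_separated hvw hy hy'
    simp at this
  · intro y hy z hz h
    have := cell_separated hvw hy hz
    rw [edist_eq_one_iff_adj.2 h] at this
    exact lt_irrefl _ this

/-- A rival `u` can spoil membership of `y` only if it arrives before `τ v + H.edist v y + 2 ≤ 2 * R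
+ 2`. It then lies within `R + (2 * R + 2)` of `v`, and its distance to `y` is realised inside the
ball. -/
theorem cell_induce_ballSet {R : ℕ} (hτ : ∀ u, τ u ≤ R) (v : W) :
    ((H.induce (H.ballSet v (3 * R + 2))).cell (fun u => τ u) (H.ballRoot v (3 * R + 2))).map
      (Embedding.induce (G := H) (H.ballSet v (3 * R + 2))).toEmbedding = H.cell τ v := by
  ext y
  rw [Finset.mem_map]
  constructor
  · rintro ⟨y, hy, rfl⟩
    have hvy := edist_le_of_mem_cell (τ := fun u : H.ballSet v (3 * R + 2) => τ u) (fun u => hτ u) hy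
    rw [edist_induce_ballRoot] at hvy
    rw [mem_cell] at hy ⊢
    intro u hu
    change (τ v : ℕ∞) + H.edist v y + 2 ≤ τ u + H.edist u y
    by_cases huy : H.edist u y ≤ (2 * R + 2 : ℕ)
    · have hvu : H.edist v y + H.edist y u ≤ (3 * R + 2 : ℕ) := by
        calc H.edist v y + H.edist y u ≤ (R : ℕ∞) + (2 * R + 2 : ℕ) := by
              rw [edist_comm (u := (y : W))]; gcongr
          _ = (3 * R + 2 : ℕ) := by norm_cast; omega
      have hu' : u ∈ H.ballSet v (3 * R + 2) := SimpleGraph.edist_triangle.trans hvu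
      have h1 := hy ⟨u, hu'⟩ (fun h => hu (congrArg Subtype.val h))
      rw [edist_induce_ballRoot, edist_comm (u := (⟨u, hu'⟩ : H.ballSet v (3 * R + 2))),
        edist_induce_ballSet y ⟨u, hu'⟩ hvu, edist_comm (u := (y : W))] at h1
      exact h1
    · calc (τ v : ℕ∞) + H.edist v y + 2 ≤ R + R + 2 := by
            gcongr
            exact_mod_cast hτ v
        _ = (2 * R + 2 : ℕ) := by norm_cast; omega
        _ ≤ H.edist u y := (not_le.1 huy).le
        _ ≤ _ := le_add_self
  · intro hy
    have hvy := edist_le_of_mem_cell hτ hy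
    have hy' : y ∈ H.ballSet v (3 * R + 2) :=
      hvy.trans (by norm_cast; omega)
    refine ⟨⟨y, hy'⟩, ?_, rfl⟩
    rw [mem_cell] at hy ⊢
    intro u hu
    rw [edist_induce_ballRoot]
    refine (hy u fun h => hu (Subtype.ext h)).trans ?_
    gcongr
    exact edist_induce_le u ⟨y, hy'⟩

theorem cell_iso {W' : Type u} [Finite W'] {H' : SimpleGraph W'} (φ : H ≃g H') (v : W)
    (τ : W' → ℕ) :
    (H.cell (fun u => τ (φ u)) v).map φ.toEmbedding.toEmbedding = H'.cell τ (φ v) := by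
  ext y
  obtain ⟨y, rfl⟩ := φ.surjective y
  rw [Finset.mem_map]
  have h : φ y ∈ H'.cell τ (φ v) ↔ y ∈ H.cell (fun u => τ (φ u)) v := by
    rw [mem_cell, mem_cell, φ.surjective.forall]
    simp only [edist_iso, ne_eq, EmbeddingLike.apply_eq_iff_eq]
  rw [h]
  constructor
  · rintro ⟨z, hz, hzy⟩
    rwa [← φ.injective hzy]
  · exact fun hy => ⟨y, hy, rfl⟩

end SimpleGraph

/-! ### Averages over product spaces -/

section Average

open scoped BigOperators

/-- The average of a function on a finite type. -/
noncomputable def average {X : Type*} [Finite X] (g : X → ℝ) : ℝ :=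
  letI := Fintype.ofFinite X
  𝔼 x, g x

theorem average_eq_expect {X : Type*} [Fintype X] (g : X → ℝ) : average g = 𝔼 x, g x := by
  unfold average
  congr!

theorem average_equiv {X Y : Type*} [Finite X] [Finite Y] (e : X ≃ Y) (g : Y → ℝ) :
    average (fun x => g (e x)) = average g := by
  classical
  let _ := Fintype.ofFinite X
  let _ := Fintype.ofFinite Y
  rw [average_eq_expect, average_eq_expect]
  exact Fintype.expect_equiv e _ _ fun _ => rfl

theorem average_restrict {W Λ : Type*} [Finite W] [Finite Λ] [Nonempty Λ] (s : Set W)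
    (g : (s → Λ) → ℝ) :
    average (fun c : W → Λ => g (fun u => c u)) = average g := by
  classical
  let _ := Fintype.ofFinite W
  let _ := Fintype.ofFinite Λ
  have h := average_equiv (Equiv.piEquivPiSubtypeProd (· ∈ s) fun _ => Λ)
    (fun P : ({x // x ∈ s} → Λ) × ({x // x ∉ s} → Λ) => g P.1)
  have h2 : average (fun P : ({x // x ∈ s} → Λ) × ({x // x ∉ s} → Λ) => g P.1) = average g := by
    rw [average_eq_expect, average_eq_expect, ← Finset.univ_product_univ, Finset.expect_product]
    simp
  rw [← h2, ← h]
  rfl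

/-- Resampling one coordinate preserves the uniform measure: exchanging the old and the new value is
an involution of `(W → Λ) × Λ`. -/
theorem expect_update {W Λ : Type*} [Fintype W] [DecidableEq W] [Fintype Λ] [Nonempty Λ] (v : W)
    (F : (W → Λ) → ℝ) :
    𝔼 c, 𝔼 a, F (Function.update c v a) = 𝔼 c, F c := by
  rw [← Finset.expect_product' (f := fun c a => F (Function.update c v a)),
    Finset.univ_product_univ]
  let e : (W → Λ) × Λ ≃ (W → Λ) × Λ :=
    { toFun := fun P => (Function.update P.1 v P.2, P.1 v)
      invFun := fun P => (Function.update P.1 v P.2, P.1 v)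
      left_inv := fun P => by simp
      right_inv := fun P => by simp }
  rw [Fintype.expect_equiv e (fun P => F (Function.update P.1 v P.2)) (fun P => F P.1) fun _ => rfl, ← Finset.univ_product_univ,
    Finset.expect_product]
  simp

end Average

/-! ### Probability of being covered, and the local approximation -/

section Covering

open SimpleGraph
open scoped BigOperators

open Classical in
/-- A random time in `{0, …, R}` for which moving the deadline two units ahead divides the
probability of being on time by at most `κ⁻¹`, up to an additive error `η`. -/
structure IsTimer {Λ : Type*} [Fintype Λ] (R : ℕ) (κ η : ℝ) (t : Λ → ℕ) : Prop where
  le : ∀ a, t a ≤ R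
  expect_le : ∀ T ≤ R, κ * (𝔼 a, if t a ≤ T then (1 : ℝ) else 0) ≤
    (𝔼 a, if t a + 2 ≤ T then (1 : ℝ) else 0) + η
  nonneg : 0 ≤ κ
  error_nonneg : 0 ≤ η

variable {W : Type u} [Fintype W] {H : SimpleGraph W} {Λ : Type*} [Fintype Λ] [Nonempty Λ]
  {R : ℕ} {κ η : ℝ} {t : Λ → ℕ}

-- Compares the event that `v` reaches `y` first, ties allowed, with the event that it leads by two.
-- With all other times fixed, both are deadlines for the time of `v`, so the timer inequality
-- applies after resampling that coordinate.
open Classical in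
theorem expect_mem_cell_ge (ht : IsTimer R κ η t) (v y : W) :
    κ * (𝔼 c : W → Λ, if ∀ u, u ≠ v → (t (c v) : ℕ∞) + H.edist v y ≤ t (c u) + H.edist u y
        then (1 : ℝ) else 0) ≤
      (𝔼 c : W → Λ, if y ∈ H.cell (fun u => t (c u)) v then (1 : ℝ) else 0) + η := by
  rw [← expect_update v, ← expect_update v (fun c => if y ∈ H.cell (fun u => t (c u)) v
    then (1 : ℝ) else 0), Finset.mul_expect]
  have hη : η = 𝔼 _c : W → Λ, η := by simp
  rw [hη, ← Finset.expect_add_distrib]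
  refine Finset.expect_le_expect fun c _ => ?_
  let P : ℕ → Prop := fun s => ∀ u, u ≠ v → (s : ℕ∞) + H.edist v y ≤ t (c u) + H.edist u y
  have hA : ∀ a, (∀ u, u ≠ v → (t (Function.update c v a v) : ℕ∞) + H.edist v y ≤
      t (Function.update c v a u) + H.edist u y) ↔ P (t a) := by
    intro a
    refine forall_congr' fun u => imp_congr_right fun hu => ?_
    rw [Function.update_self, Function.update_of_ne hu]
  have hD : ∀ a, P (t a + 2) → y ∈ H.cell (fun u => t (Function.update c v a u)) v := by
    intro a h
    rw [mem_cell]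
    intro u hu
    rw [Function.update_self, Function.update_of_ne hu]
    have := h u hu
    push_cast at this
    rwa [add_right_comm] at this
  have hmono : ∀ s s', s ≤ s' → P s' → P s := by
    intro s s' hs h u hu
    refine le_trans ?_ (h u hu)
    gcongr
  simp only [hA]
  by_cases hex : ∃ s ≤ R, P s
  -- `P` is downward closed, so arriving first means starting by the deadline `T`, and starting by
  -- `T - 2` gives the lead of two.
  · let T := Nat.findGreatest P R
    obtain ⟨s, hs, hPs⟩ := hex
    have hT : P T := Nat.findGreatest_spec hs hPs
    have h1 : (𝔼 a, if P (t a) then (1 : ℝ) else 0) ≤ 𝔼 a, if t a ≤ T then (1 : ℝ) else 0 := by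
      refine Finset.expect_le_expect fun a _ => ?_
      by_cases h : P (t a)
      · rw [if_pos h, if_pos (Nat.le_findGreatest (ht.le a) h)]
      · rw [if_neg h]; split_ifs <;> norm_num
    have h2 : (𝔼 a, if t a + 2 ≤ T then (1 : ℝ) else 0) ≤
        𝔼 a, if y ∈ H.cell (fun u => t (Function.update c v a u)) v then (1 : ℝ) else 0 := by
      refine Finset.expect_le_expect fun a _ => ?_
      by_cases h : t a + 2 ≤ T
      · rw [if_pos h, if_pos (hD a (hmono _ _ h hT))]
      · rw [if_neg h]; split_ifs <;> norm_num
    have h3 := ht.expect_le T (Nat.findGreatest_le R)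
    have h4 := mul_le_mul_of_nonneg_left h1 ht.nonneg
    linarith
  · push Not at hex
    have h1 : (𝔼 a, if P (t a) then (1 : ℝ) else 0) = 0 := by
      refine Finset.expect_eq_zero fun a _ => ?_
      rw [if_neg (hex _ (ht.le a))]
    rw [h1, mul_zero]
    have h2 : 0 ≤ 𝔼 a, if y ∈ H.cell (fun u => t (Function.update c v a u)) v
        then (1 : ℝ) else 0 :=
      Finset.expect_nonneg fun a _ => by split_ifs <;> norm_num
    linarith [ht.error_nonneg]

/-- Some vertex reaches `y` first. -/
theorem exists_first (H : SimpleGraph W) (τ : W → ℕ) (y : W) :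
    ∃ v, ∀ u, u ≠ v → (τ v : ℕ∞) + H.edist v y ≤ τ u + H.edist u y := by
  have : Nonempty W := ⟨y⟩
  obtain ⟨v, hv⟩ := Finite.exists_min fun v => (τ v : ℕ∞) + H.edist v y
  exact ⟨v, fun u _ => hv u⟩

-- Some centre reaches `y` first, and it lies in the `R`-ball of `y` since `y` reaches itself by
-- time `R`. Summing `expect_mem_cell_ge` over that ball costs one error `η` per vertex, and
-- disjointness of cells turns the sum into the probability of a union.
open Classical in
theorem expect_exists_mem_cell_ge (ht : IsTimer R κ η t) (y : W) :
    κ - (H.ballSet y R).ncard * η ≤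
      𝔼 c : W → Λ, if ∃ v, y ∈ H.cell (fun u => t (c u)) v then (1 : ℝ) else 0 := by
  let B : Finset W := (Set.toFinite (H.ballSet y R)).toFinset
  have hB : (B.card : ℝ) = (H.ballSet y R).ncard := by
    rw [Set.ncard_eq_toFinset_card _ (Set.toFinite _)]
  have h1 : ∀ c : W → Λ, (∑ v ∈ B, if y ∈ H.cell (fun u => t (c u)) v then (1 : ℝ) else 0) ≤
      if ∃ v, y ∈ H.cell (fun u => t (c u)) v then (1 : ℝ) else 0 := by
    intro c
    by_cases h : ∃ v, y ∈ H.cell (fun u => t (c u)) v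
    · rw [if_pos h, Finset.sum_boole]
      norm_cast
      rw [Finset.card_le_one]
      intro v hv w hw
      by_contra hvw
      exact Finset.disjoint_left.1 (disjoint_cell hvw).1 (Finset.mem_filter.1 hv).2
        (Finset.mem_filter.1 hw).2
    · push Not at h
      rw [if_neg (by push Not; exact h)]
      exact (Finset.sum_eq_zero fun v _ => if_neg (h v)).le
  have h2 : ∀ c : W → Λ, (1 : ℝ) ≤ ∑ v ∈ B, if ∀ u, u ≠ v →
      (t (c v) : ℕ∞) + H.edist v y ≤ t (c u) + H.edist u y then (1 : ℝ) else 0 := by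
    intro c
    obtain ⟨v, hv⟩ := exists_first H (fun u => t (c u)) y
    have hvB : v ∈ B := by
      simp only [B, Set.Finite.mem_toFinset, ballSet, Set.mem_ofPred_eq]
      by_cases hvy : y = v
      · simp [hvy]
      · have := hv y hvy
        rw [edist_self, add_zero] at this
        rw [edist_comm]
        exact le_add_self.trans (this.trans (by exact_mod_cast ht.le _))
    have := Finset.single_le_sum (f := fun v => if ∀ u, u ≠ v →
      (t (c v) : ℕ∞) + H.edist v y ≤ t (c u) + H.edist u y then (1 : ℝ) else 0)
      (fun v _ => by split_ifs <;> norm_num) hvB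
    refine le_trans ?_ this
    rw [if_pos hv]
  have h3 : (1 : ℝ) ≤ ∑ v ∈ B, 𝔼 c : W → Λ, if ∀ u, u ≠ v →
      (t (c v) : ℕ∞) + H.edist v y ≤ t (c u) + H.edist u y then (1 : ℝ) else 0 := by
    rw [← Finset.expect_sum_comm]
    calc (1 : ℝ) = 𝔼 _c : W → Λ, (1 : ℝ) := by simp
      _ ≤ _ := Finset.expect_le_expect fun c _ => h2 c
  have h4 : κ * 1 ≤ ∑ v ∈ B, ((𝔼 c : W → Λ, if y ∈ H.cell (fun u => t (c u)) v
      then (1 : ℝ) else 0) + η) := by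
    refine (mul_le_mul_of_nonneg_left h3 ht.nonneg).trans ?_
    rw [Finset.mul_sum]
    exact Finset.sum_le_sum fun v _ => expect_mem_cell_ge ht v y
  rw [Finset.sum_add_distrib, Finset.sum_const, nsmul_eq_mul, hB, ← Finset.expect_sum_comm] at h4
  have h5 := Finset.expect_le_expect (s := Finset.univ) fun c _ => h1 c
  linarith

/-- The average contribution of the cell of `v` to the parameter `q`. -/
noncomputable def cellAverage (q : ∀ ⦃W : Type u⦄, SimpleGraph W → Finset W → ℝ)
    {Λ : Type*} [Finite Λ] (t : Λ → ℕ) {W : Type u} [Finite W] (H : SimpleGraph W) (v : W) : ℝ :=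
  average fun c : W → Λ => q H (H.cell (fun u => t (c u)) v)

variable {d : ℕ} {C : ℝ} {q : ∀ ⦃W : Type u⦄, SimpleGraph W → Finset W → ℝ}

omit [Nonempty Λ] in
theorem cellAverage_iso (hq : IsAdditiveParameter d C q) {W W' : Type u} [Finite W] [Finite W']
    {H : SimpleGraph W} {H' : SimpleGraph W'} (φ : H ≃g H') (v : W) :
    cellAverage q t H v = cellAverage q t H' (φ v) := by
  unfold cellAverage
  rw [← average_equiv (Equiv.arrowCongr φ.toEquiv.symm (Equiv.refl Λ))]
  congr 1
  ext c
  rw [← hq.map φ.toEmbedding, ← cell_iso φ v]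
  simp

/-- The cell depends only on the times inside the ball, so the other coordinates average out. -/
theorem cellAverage_ball (hq : IsAdditiveParameter d C q) (ht : IsTimer R κ η t) (v : W) :
    cellAverage q t (H.induce (H.ballSet v (3 * R + 2))) (H.ballRoot v (3 * R + 2)) =
      cellAverage q t H v := by
  unfold cellAverage
  rw [← average_restrict]
  congr 1
  ext c
  rw [← cell_induce_ballSet (fun u => ht.le (c u)) v, hq.map]

/-- For each choice of times the error is at most `C` times the number of uncovered vertices, and
each vertex is uncovered with probability at most `ε`. -/
theorem abs_sub_sum_cellAverage_le (hq : IsAdditiveParameter d C q) (hC : 0 ≤ C)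
    (ht : IsTimer R κ η t) (hd : H.DegreeBoundedBy d) {ε : ℝ}
    (hε : ∀ y, 1 - ε ≤ κ - (H.ballSet y R).ncard * η) :
    |q H Finset.univ - ∑ v, cellAverage q t H v| ≤ C * ε * Fintype.card W := by
  classical
  unfold cellAverage
  simp only [average_eq_expect]
  rw [← Finset.expect_sum_comm]
  have h0 : q H Finset.univ = 𝔼 _c : W → Λ, q H Finset.univ := by simp
  rw [h0, ← Finset.expect_sub_distrib]
  refine (Finset.abs_expect_le _ _).trans ?_
  have h1 : ∀ c : W → Λ, |q H Finset.univ - ∑ v, q H (H.cell (fun u => t (c u)) v)| ≤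
      C * ∑ y, (1 - if ∃ v, y ∈ H.cell (fun u => t (c u)) v then (1 : ℝ) else 0) := by
    intro c
    rw [← hq.biUnion _ _ fun _ _ h => disjoint_cell h]
    let U := Finset.univ.biUnion (H.cell fun u => t (c u))
    have h := hq.abs_sub_le hd U Uᶜ
    rw [Finset.union_comm, Finset.union_compl] at h
    refine h.trans (mul_le_mul_of_nonneg_left (le_of_eq ?_) hC)
    rw [Finset.card_compl, Nat.cast_sub (Finset.card_le_univ _), Finset.sum_sub_distrib,
      Finset.sum_boole]
    simp only [Finset.sum_const, Finset.card_univ, nsmul_eq_mul, mul_one]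
    congr 3
    ext y
    simp [U]
  refine (Finset.expect_le_expect fun c _ => h1 c).trans ?_
  rw [← Finset.mul_expect, Finset.expect_sum_comm, mul_assoc]
  refine mul_le_mul_of_nonneg_left ?_ hC
  calc _ ≤ ∑ _y : W, ε := by
        refine Finset.sum_le_sum fun y _ => ?_
        rw [Finset.expect_sub_distrib]
        have := (hε y).trans (expect_exists_mem_cell_ge (H := H) ht y)
        simp only [Fintype.expect_const]
        linarith
    _ = ε * Fintype.card W := by simp [mul_comm]

end Covering

/-! ### Truncated geometric start times and the choice of the radius -/

section Timer

open scoped BigOperators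

theorem exists_isTimer (k R : ℕ) (hk : 2 ≤ k) :
    ∃ t : Fin (k ^ R) → ℕ, IsTimer R ((1 - 1 / (k : ℝ)) ^ 2) ((1 - 1 / (k : ℝ)) ^ (R - 1)) t := by
  classical
  have hk0 : (0 : ℝ) < k := by positivity
  have hθ0 : 0 ≤ 1 - 1 / (k : ℝ) := by
    rw [sub_nonneg, div_le_one hk0]; exact_mod_cast (by omega : 1 ≤ k)
  have hθ1 : 1 - 1 / (k : ℝ) ≤ 1 := by
    have : 0 ≤ 1 / (k : ℝ) := by positivity
    linarith
  -- The time of `a` is the first `s` whose threshold exceeds `a`. The threshold for `s` is the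
  -- fraction `(1 - 1/k)^(R - s)` of `k ^ R`, which realises the desired distribution by a uniform
  -- choice.
  have hex : ∀ a : Fin (k ^ R), ∃ s, (a : ℕ) < (k - 1) ^ (R - s) * k ^ s := fun a =>
    ⟨R, by simp⟩
  have hmono : ∀ s, s < R → (k - 1) ^ (R - s) * k ^ s ≤ (k - 1) ^ (R - (s + 1)) * k ^ (s + 1) := by
    intro s hs
    have : R - s = (R - (s + 1)) + 1 := by omega
    rw [this, pow_succ, pow_succ, mul_assoc, mul_comm (k ^ s)]
    gcongr
    omega
  have hmono' : ∀ s s', s ≤ s' → s' ≤ R →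
      (k - 1) ^ (R - s) * k ^ s ≤ (k - 1) ^ (R - s') * k ^ s' := by
    intro s s' hs hs'
    induction s', hs using Nat.le_induction with
    | base => rfl
    | succ n hn ih => exact (ih (by omega)).trans (hmono n (by omega))
  let t : Fin (k ^ R) → ℕ := fun a => Nat.find (hex a)
  have ht : ∀ a, ∀ s ≤ R, t a ≤ s ↔ (a : ℕ) < (k - 1) ^ (R - s) * k ^ s := by
    intro a s hs
    constructor
    · intro h
      exact (Nat.find_spec (hex a)).trans_le (hmono' _ _ h hs)
    · exact fun h => Nat.find_min' _ h
  have hE : ∀ s ≤ R, (𝔼 a, if t a ≤ s then (1 : ℝ) else 0) = (1 - 1 / (k : ℝ)) ^ (R - s) := by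
    intro s hs
    have hle : (k - 1) ^ (R - s) * k ^ s ≤ k ^ R := by
      have := hmono' s R hs le_rfl
      simpa using this
    rw [Fintype.expect_eq_sum_div_card, Finset.sum_boole]
    have hc : (Finset.univ.filter fun a => t a ≤ s).card = (k - 1) ^ (R - s) * k ^ s := by
      simp only [ht _ s hs]
      rw [Fin.card_filter_val_lt, min_eq_right hle]
    rw [hc, Fintype.card_fin]
    push_cast
    rw [Nat.cast_sub (by omega)]
    have hR : (k : ℝ) ^ R = k ^ (R - s) * k ^ s := by rw [← pow_add]; congr 1; omega
    rw [hR, mul_div_mul_right _ _ (by positivity), ← div_pow]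
    congr 1
    push_cast
    field_simp
  refine ⟨t, fun a => (ht a R le_rfl).2 (by simp), ?_, by positivity, by positivity⟩
  intro T hT
  rw [hE T hT, ← pow_add]
  by_cases h2 : 2 ≤ T
  · have : (𝔼 a, if t a + 2 ≤ T then (1 : ℝ) else 0) = 𝔼 a, if t a ≤ T - 2 then (1 : ℝ) else 0 :=
      Finset.expect_congr rfl fun a _ => by simp only [Nat.le_sub_iff_add_le h2]
    rw [this, hE _ (by omega)]
    have : 2 + (R - T) = R - (T - 2) := by omega
    rw [this]
    have : 0 ≤ (1 - 1 / (k : ℝ)) ^ (R - 1) := by positivity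
    linarith
  -- For `T ≤ 1` the left side is `(1 - 1/k)^(2 + R - T)`, with exponent at least `R - 1`, so the
  -- additive error alone absorbs it.
  · have h0 : (0 : ℝ) ≤ 𝔼 a, if t a + 2 ≤ T then (1 : ℝ) else 0 :=
      Finset.expect_nonneg fun a _ => by split_ifs <;> norm_num
    have := pow_le_pow_of_le_one hθ0 hθ1 (by omega : R - 1 ≤ 2 + (R - T))
    linarith

/-- With `b = 1/k < ε/4` the square loses less than `ε/2`. Growth at rate `1 + b` loses to decay at
rate `1 - b`, since `(1 + b) * (1 - b) < 1`, so a large `R` makes the other term less than `ε/2`. -/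
theorem SubexpGrowth.exists_radius {f : ℕ → ℝ} (hf : SubexpGrowth f) {ε : ℝ} (hε : 0 < ε) :
    ∃ k R : ℕ, 2 ≤ k ∧ 1 - ε ≤ (1 - 1 / (k : ℝ)) ^ 2 - f R * (1 - 1 / (k : ℝ)) ^ (R - 1) := by
  obtain ⟨k, hk⟩ := exists_nat_gt (max 2 (4 / ε))
  have hk2 : (2 : ℝ) < k := (le_max_left _ _).trans_lt hk
  have hk4 : 4 / ε < k := (le_max_right _ _).trans_lt hk
  have hk0 : (0 : ℝ) < k := by linarith
  have hinv : 1 / (k : ℝ) < ε / 4 := by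
    rw [div_lt_iff₀ hε] at hk4
    rw [div_lt_iff₀ hk0]
    linarith
  have hinv0 : 0 < 1 / (k : ℝ) := by positivity
  have hinv1 : 1 / (k : ℝ) < 1 := by rw [div_lt_one hk0]; linarith
  obtain ⟨C, hC, hfC⟩ := hf (1 / k) hinv0
  set b := 1 / (k : ℝ) with hb
  have hlim : Tendsto (fun n : ℕ => C * (1 + b) * ((1 + b) * (1 - b)) ^ n) atTop (𝓝 0) := by
    rw [← mul_zero (C * (1 + b))]
    refine (tendsto_pow_atTop_nhds_zero_of_lt_one ?_ ?_).const_mul _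
    · exact mul_nonneg (by linarith) (by linarith)
    · nlinarith
  obtain ⟨n, hn⟩ := (hlim.eventually (gt_mem_nhds (half_pos hε))).exists
  refine ⟨k, n + 1, by exact_mod_cast hk2.le, ?_⟩
  have h1 := hfC (n + 1) (by omega)
  have h2 : f (n + 1) * (1 - b) ^ n ≤ C * (1 + b) * ((1 + b) * (1 - b)) ^ n := by
    calc _ ≤ C * (1 + b) ^ (n + 1) * (1 - b) ^ n :=
          mul_le_mul_of_nonneg_right h1 (pow_nonneg (by linarith) _)
      _ = _ := by rw [mul_pow, pow_succ]; ring
  simp only [Nat.add_sub_cancel]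
  nlinarith

end Timer

/-! ### Averages of rooted-ball invariants -/

section Patches

open SimpleGraph

/-- Rooted isomorphism. -/
def RootedBall.setoid (r d : ℕ) : Setoid (RootedBall r d) where
  r α β := ∃ φ : α.graph ≃g β.graph, φ α.root = β.root
  iseqv :=
    { refl := fun _ => ⟨Iso.refl, rfl⟩
      symm := fun ⟨φ, h⟩ => ⟨φ.symm, by rw [← h]; exact φ.symm_apply_apply _⟩
      trans := fun ⟨φ, h⟩ ⟨ψ, h'⟩ => ⟨φ.trans ψ, by rw [← h', ← h]; rfl⟩ }

theorem RootedBall.finite_setOf_le (r d N : ℕ) : {α : RootedBall r d | α.n ≤ N}.Finite := by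
  let g : {α : RootedBall r d | α.n ≤ N} → Σ n : Fin (N + 1), SimpleGraph (Fin n) × Fin n :=
    fun α => ⟨⟨α.1.n, Nat.lt_succ_of_le α.2⟩, α.1.graph, α.1.root⟩
  have hg : Function.Injective g := by
    rintro ⟨⟨n, G, x, _, _, _⟩, h⟩ ⟨⟨n', G', x', _, _, _⟩, h'⟩ hab
    simp only [g, Sigma.mk.injEq, Fin.mk.injEq] at hab
    obtain ⟨rfl, hab⟩ := hab
    simp only [heq_eq_eq, Prod.mk.injEq] at hab
    obtain ⟨rfl, rfl⟩ := hab
    rfl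
  exact Finite.of_injective g hg

variable {W : Type u} [Finite W] {H : SimpleGraph W} {r d : ℕ}

theorem exists_mem_patchSet (hd : H.DegreeBoundedBy d) (x : W) :
    ∃ α : RootedBall r d, α.n = (H.ballSet x r).ncard ∧ x ∈ patchSet H α := by
  let e := Finite.equivFin (H.ballSet x r)
  let K := H.induce (H.ballSet x r)
  let φ : K.map e.toEmbedding ≃g K := (Iso.map e K).symm
  have hroot : φ (e (H.ballRoot x r)) = H.ballRoot x r := e.symm_apply_apply _
  have hconn : K.Connected := by
    rw [connected_iff_exists_forall_reachable]
    refine ⟨H.ballRoot x r, fun a => ?_⟩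
    rw [← edist_ne_top_iff_reachable, edist_induce_ballRoot]
    exact ne_top_of_le_ne_top (ENat.natCast_ne_top r) a.2
  refine ⟨⟨Nat.card (H.ballSet x r), K.map e.toEmbedding, e (H.ballRoot x r),
    φ.connected_iff.2 hconn, ?_, ?_⟩, rfl, φ, hroot⟩
  · intro y
    refine ⟨Set.toFinite _, ?_⟩
    refine le_trans ?_ (hd (φ y)).2
    refine Set.ncard_le_ncard_of_injOn (fun z => (φ z : W)) ?_ ?_ (hd _).1
    · intro z hz
      exact φ.map_rel_iff.2 hz
    · intro z _ z' _ h
      exact φ.injective (Subtype.ext h)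
  · intro y
    refine ENat.toNat_le_of_le_natCast ?_
    rw [← edist_iso φ, hroot, edist_induce_ballRoot]
    exact (φ y).2

/-- In a weakly convergent sequence of graphs whose `r`-balls have bounded size, the averages of
an invariant of the rooted `r`-balls converge. -/
theorem WeaklyConvergentIn.exists_tendsto_sum_div {W : ℕ → Type u} [∀ n, Fintype (W n)]
    {H : ∀ n, SimpleGraph (W n)} (hH : WeaklyConvergentIn d H) (hr : 1 ≤ r) {N : ℕ}
    (hN : ∀ n x, ((H n).ballSet x r).ncard ≤ N)
    (ψ : ∀ ⦃W : Type u⦄ [Finite W], SimpleGraph W → W → ℝ)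
    (hψ : ∀ ⦃W W' : Type u⦄ [Finite W] [Finite W'] (K : SimpleGraph W) (K' : SimpleGraph W')
      (φ : K ≃g K') (x : W), ψ K x = ψ K' (φ x)) :
    ∃ c : ℝ, Tendsto (fun n => (∑ x, ψ ((H n).induce ((H n).ballSet x r)) ((H n).ballRoot x r)) /
      (Fintype.card (W n) : ℝ)) atTop (𝓝 c) := by
  classical
  let s := RootedBall.setoid r d
  let A : Finset (Quotient s) :=
    ((RootedBall.finite_setOf_le r d N).image (Quotient.mk s)).toFinset
  have hA : ∀ n x, ∃ a ∈ A, x ∈ patchSet (H n) a.out := by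
    intro n x
    obtain ⟨α, hα, φ, hφ⟩ := exists_mem_patchSet (r := r) (hH.1 n) x
    obtain ⟨ψ, hψ⟩ : s.r (Quotient.mk s α).out α := Quotient.mk_out α
    refine ⟨Quotient.mk s α, ?_, ψ.trans φ, ?_⟩
    · rw [Set.Finite.mem_toFinset]
      exact ⟨α, hα.trans_le (hN n x), rfl⟩
    · rw [← hφ, ← hψ]; rfl
  have hA' : ∀ n x a b, x ∈ patchSet (H n) (Quotient.out a : RootedBall r d) →
      x ∈ patchSet (H n) (Quotient.out (s := s) b) → a = b := by
    rintro n x a b ⟨φ, hφ⟩ ⟨φ', hφ'⟩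
    rw [← Quotient.out_equiv_out]
    refine ⟨φ.trans φ'.symm, ?_⟩
    change φ'.symm (φ _) = _
    rw [hφ, ← hφ', φ'.symm_apply_apply]
  -- The value on a class is read off from an occurrence in the sequence, because the representative
  -- lives on some `Fin n`, outside the universe of `ψ`. Classes that never occur have frequency
  -- zero, so their value is immaterial.
  let val : Quotient s → ℝ := fun a =>
    if h : ∃ P : Σ n, W n, P.2 ∈ patchSet (H P.1) a.out then
      ψ ((H h.choose.1).induce ((H h.choose.1).ballSet h.choose.2 r))
        ((H h.choose.1).ballRoot h.choose.2 r)
    else 0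
  have hval : ∀ n x a, x ∈ patchSet (H n) (Quotient.out a : RootedBall r d) →
      ψ ((H n).induce ((H n).ballSet x r)) ((H n).ballRoot x r) = val a := by
    intro n x a hx
    have h : ∃ P : Σ n, W n, P.2 ∈ patchSet (H P.1) (Quotient.out a : RootedBall r d) :=
      ⟨⟨n, x⟩, hx⟩
    simp only [val, dif_pos h]
    obtain ⟨φ, hφ⟩ := hx
    obtain ⟨φ', hφ'⟩ := h.choose_spec
    rw [hψ _ _ (φ.symm.trans φ'), ← hφ']
    congr 1
    change φ' (φ.symm _) = _
    rw [← hφ, φ.symm_apply_apply]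
  have hsum : ∀ n, (∑ x, ψ ((H n).induce ((H n).ballSet x r)) ((H n).ballRoot x r)) /
      (Fintype.card (W n) : ℝ) = ∑ a ∈ A, val a * patchFreq (H n) (Quotient.out a) := by
    intro n
    have h1 : ∀ x, ψ ((H n).induce ((H n).ballSet x r)) ((H n).ballRoot x r) =
        ∑ a ∈ A, if x ∈ patchSet (H n) (Quotient.out a) then val a else 0 := by
      intro x
      obtain ⟨a, ha, hx⟩ := hA n x
      rw [Finset.sum_eq_single_of_mem a ha, if_pos hx, hval n x a hx]
      exact fun b _ hb => if_neg fun h => hb (hA' n x b a h hx)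
    simp only [h1, patchFreq]
    rw [Finset.sum_comm, Finset.sum_div]
    refine Finset.sum_congr rfl fun a _ => ?_
    rw [← Finset.sum_filter, Finset.sum_const, nsmul_eq_mul, mul_comm, mul_div_assoc,
      Set.ncard_eq_toFinset_card']
    congr 3
    exact congrArg Finset.card (Finset.ext fun x => by simp)
  choose p hp using fun a : Quotient s => hH.2.2 r hr a.out
  refine ⟨∑ a ∈ A, val a * p a, ?_⟩
  simp only [hsum]
  exact tendsto_finsetSum _ fun a _ => (hp a).const_mul _

end Patches

/-! ### Convergence of additive parameters and the theorem -/

section Convergence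

open SimpleGraph

theorem exists_tendsto_of_approx {x : ℕ → ℝ}
    (h : ∀ ε > 0, ∃ y : ℕ → ℝ, (∃ c, Tendsto y atTop (𝓝 c)) ∧ ∀ n, |x n - y n| ≤ ε) :
    ∃ c, Tendsto x atTop (𝓝 c) := by
  refine cauchySeq_tendsto_of_complete (Metric.cauchySeq_iff'.2 fun ε hε => ?_)
  obtain ⟨y, ⟨c, hc⟩, hy⟩ := h (ε / 4) (by positivity)
  obtain ⟨N, hN⟩ := Metric.cauchySeq_iff'.1 hc.cauchySeq (ε / 4) (by positivity)
  refine ⟨N, fun n hn => ?_⟩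
  have h1 := hN n hn
  rw [Real.dist_eq] at h1 ⊢
  have h2 := abs_sub_le (x n) (y n) (x N)
  have h3 := abs_sub_le (y n) (y N) (x N)
  have h4 := hy N
  rw [abs_sub_comm] at h4
  linarith [hy n]

/-- Additive parameters converge along weakly convergent sequences of graphs of uniformly
subexponential growth. -/
theorem SimpleGraph.IsAdditiveParameter.exists_tendsto {d : ℕ} {C : ℝ}
    {q : ∀ ⦃W : Type u⦄, SimpleGraph W → Finset W → ℝ} (hq : IsAdditiveParameter d C q)
    (hC : 0 ≤ C) {f : ℕ → ℝ} (hf : SubexpGrowth f) {W : ℕ → Type u} [∀ n, Fintype (W n)]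
    {H : ∀ n, SimpleGraph (W n)} (hH : WeaklyConvergentIn d H)
    (hG : ∀ n, (H n).GrowthBoundedBy f) :
    ∃ c : ℝ, Tendsto (fun n => q (H n) Finset.univ / (Fintype.card (W n) : ℝ)) atTop (𝓝 c) := by
  refine exists_tendsto_of_approx fun ε hε => ?_
  -- The final error is `C * (ε / (C + 1)) ≤ ε`; the summand `1` avoids division by zero when `C =
  -- 0`.
  obtain ⟨k, R, hk, hkR⟩ := hf.exists_radius (ε := ε / (C + 1)) (by positivity)
  obtain ⟨t, ht⟩ := exists_isTimer k R hk
  have : Nonempty (Fin (k ^ R)) := ⟨⟨0, by positivity⟩⟩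
  refine ⟨_, hH.exists_tendsto_sum_div (r := 3 * R + 2) (by omega) (N := ⌊f (3 * R + 2)⌋₊)
    (fun n x => Nat.le_floor ((hG n x (3 * R + 2)).2)) (fun _ _ K v => cellAverage q t K v)
    (fun _ _ _ _ _ _ φ x => cellAverage_iso hq φ x), fun n => ?_⟩
  · simp only [cellAverage_ball hq ht]
    have h := abs_sub_sum_cellAverage_le hq hC ht (hH.1 n) (ε := ε / (C + 1)) fun y => by
      refine hkR.trans (sub_le_sub_left (mul_le_mul_of_nonneg_right (hG n y R).2 ?_) _)
      exact ht.error_nonneg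
    rw [← sub_div, abs_div, Nat.abs_cast]
    refine div_le_of_le_mul₀ (by positivity) hε.le (h.trans ?_)
    refine mul_le_mul_of_nonneg_right ?_ (by positivity)
    rw [mul_div_assoc', div_le_iff₀ (by positivity)]
    nlinarith

theorem SimpleGraph.GrowthBoundedBy.induce {V : Type u} {G : SimpleGraph V} {f : ℕ → ℝ}
    (hG : G.GrowthBoundedBy f) (s : Set V) : (G.induce s).GrowthBoundedBy f := by
  intro x r
  have hmaps : Set.MapsTo Subtype.val ((G.induce s).ballSet x r) (G.ballSet x r) :=
    fun y hy => (edist_induce_le x y).trans hy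
  obtain ⟨hfin, hle⟩ := hG x r
  refine ⟨Set.Finite.of_injOn hmaps Subtype.val_injective.injOn hfin, le_trans ?_ hle⟩
  exact_mod_cast Set.ncard_le_ncard_of_injOn _ hmaps Subtype.val_injective.injOn hfin

end Convergence
theorem theorem5 {V : Type u} [Infinite V] (G : SimpleGraph V) (hconn : G.Connected)
    (f : ℕ → ℝ) (hf : SubexpGrowth f) (hG : G.GrowthBoundedBy f) (hUPF : G.UPF)
    (F : ℕ → Finset V) (hF : G.IsFolner F) :
    (∃ c : ℝ, Tendsto (fun n => ((G.finInduce (F n)).indepNum : ℝ) / ((F n).card : ℝ))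
      atTop (𝓝 c)) ∧
    (∃ c : ℝ, Tendsto (fun n => (maxMatching (G.finInduce (F n)) : ℝ) / ((F n).card : ℝ))
      atTop (𝓝 c)) ∧
    (∀ lam : ℝ, 0 < lam → ∃ c : ℝ,
      Tendsto (fun n => Real.log (indepPartition (G.finInduce (F n)) lam) / ((F n).card : ℝ))
        atTop (𝓝 c)) ∧
    (∀ lam : ℝ, 0 < lam → ∃ c : ℝ,
      Tendsto (fun n => Real.log (matchingPartition (G.finInduce (F n)) lam) / ((F n).card : ℝ))
        atTop (𝓝 c)) := by
  obtain ⟨d, -, hH⟩ := hUPF F hF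
  have hgrowth : ∀ n, (G.finInduce (F n)).GrowthBoundedBy f := fun n => hG.induce _
  have hcard : ∀ n, Fintype.card (F n : Set V) = (F n).card := fun n => by simp
  have hlog : ∀ lam : ℝ, 0 < lam → 0 ≤ Real.log (1 + lam) := fun lam hl =>
    Real.log_nonneg (by linarith)
  refine ⟨?_, ?_, fun lam hl => ?_, fun lam hl => ?_⟩
  · simpa only [hcard, indepNum_eq_indepMax] using
      (SimpleGraph.isAdditiveParameter_indepMax d).exists_tendsto zero_le_one hf hH hgrowth
  · simpa only [hcard, maxMatching, matchings_eq_indepIn, SimpleGraph.indepMax] using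
      (SimpleGraph.isAdditiveParameter_matchingMax d).exists_tendsto (by positivity) hf hH hgrowth
  · simpa only [hcard, indepPartition, indepSets_eq_indepIn, SimpleGraph.indepSum] using
      (SimpleGraph.isAdditiveParameter_log_indepSum d hl).exists_tendsto (hlog lam hl) hf hH hgrowth
  · simpa only [hcard, matchingPartition, matchings_eq_indepIn, SimpleGraph.indepSum] using
      (SimpleGraph.isAdditiveParameter_log_matchingSum d hl).exists_tendsto
        (mul_nonneg (hlog lam hl) (by positivity)) hf hH hgrowth
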